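/- Let $\pi:X\to\mathbb P^3$ be the blow-up of complex projective $3$-space at a point $p_0$ (in suitable homogeneous coordinates $p_0=[1:0:0:0]$), let $H$ be the pull-back of the class of a plane and $E$ the class of the exceptional divisor, so that $\mathrm{Pic}(X)=\mathbb ZH\oplus\mathbb ZE$ with $H\cdot E=0$ and $H^3=E^3=1$. Write $\mathcal O_X(p,q)=\mathcal O_X(pH+qE)$ and $\mathcal F(p,q)=\mathcal F\otimes\mathcal O_X(p,q)$. For a torsion-free coherent sheaf $\mathcal F$ of rank $r>0$ on $X$ put $\mu(\mathcal F)=c_1(\mathcal F)\cdot h^2/r$, where $h=2H-E=-\tfrac12K_X$; $\mathcal F$ is $\mu$-stable (resp. $\mu$-semistable) if $\mu(\mathcal G)<\mu(\mathcal F)$ (resp. $\le$) for every coherent subsheaf $\mathcal G\subset\mathcal F$ with $0<\mathrm{rk}\,\mathcal G<r$. An instanton sheaf of rank $r$ on $X$ is a torsion-free $\mu$-semistable coherent sheaf $\mathcal F$ of rank $r$ with $c_1(\mathcal F)=0$ such that $H^0(\mathcal F)=H^3(\mathcal F(-4,1))=0$, $H^1(\mathcal F(-2,1))=H^2(\mathcal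 F(-2,1))=0$ and $H^2(\mathcal F(0,-1))=H^2(\mathcal F(-1,1))=0$. Let $\mathcal E$ be an instanton sheaf of rank $2$ on $X$. An elementary transformation datum for $\mathcal E$ is a triple $(\Sigma,\mathcal L,\phi)$ where 1. $i:\Sigma\hookrightarrow X$ is an embedded reduced, possibly reducible, locally complete intersection curve, of arithmetic genus $g$; 2. $\mathcal L$ is a line bundle of degree $g-1$ on $\Sigma$ with $H^0(i_*\mathcal L)=H^1(i_*\mathcal L)=0$; 3. $\phi:\mathcal E\to i_*\mathcal L\otimes\mathcal O_X(2,-1)$ is a surjective morphism such that the induced maps $H^1(\mathcal E(-1,1))\to H^1(i_*\mathcal L\otimes\mathcal O_X(1,0))$ and $H^1(\mathcal E(-1,0))\to H^1(i_*\mathcal L\otimes\mathcal O_X(1,-1))$ are surjective. The elementary transform of $\mathcal E$ along this datum is $\mathcal F=\ker\phi$. **Lemma.** If $\mathcal E$ is a $\mu$-stable instanton sheaf of rank $2$ on $X$ and $(\Sigma,\mathcal L,\phi)$ is an elementary transformation datum for $\mathcal E$, then the elementary transform $\mathcal F=\ker\phi$ is also $\mu$-stable. -/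

import Mathlib

open CategoryTheory AlgebraicGeometry TopologicalSpace Opposite

namespace InstantonBlowup

noncomputable section

/-! ### Sheaves of modules on a scheme -/

section Modules

variable {X : Scheme.{0}}

/-- Restriction of functions to a smaller open set. -/
abbrev resFun {U V : X.Opens} (h : V ≤ U) (f : Γ(X, U)) : Γ(X, V) :=
  X.presheaf.map (homOfLE h).op f

/-- Restriction of sections of a sheaf of modules to a smaller open set. -/
abbrev resSec (M : X.Modules) {U V : X.Opens} (h : V ≤ U) (s : Γ(M, U)) : Γ(M, V) :=
  M.presheaf.map (homOfLE h).op s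

/-- The tensor product `M ⊗ N` of `𝒪_X`-modules: the sheaf associated to
`U ↦ M(U) ⊗ N(U)`. -/
def tensor (M N : X.Modules) : X.Modules :=
  (PresheafOfModules.sheafification (𝟙 X.ringCatSheaf.obj)).obj
    (MonoidalCategory.tensorObj
      (C := PresheafOfModules (X.presheaf ⋙ forget₂ CommRingCat RingCat)) M.val N.val)

/-- The morphism `φ ⊗ id : M ⊗ N ⟶ M' ⊗ N`. -/
def tensorMap {M M' : X.Modules} (φ : M ⟶ M') (N : X.Modules) : tensor M N ⟶ tensor M' N :=
  (PresheafOfModules.sheafification (𝟙 X.ringCatSheaf.obj)).map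
    (MonoidalCategory.whiskerRight
      (C := PresheafOfModules (X.presheaf ⋙ forget₂ CommRingCat RingCat)) φ.val N.val)

/-- Sheaf cohomology `Hⁿ(X, M)`. -/
abbrev H (M : X.Modules) (n : ℕ) : Type :=
  Sheaf.H ((SheafOfModules.toSheaf X.ringCatSheaf).obj M) n

/-- The map `Hⁿ(X, M) → Hⁿ(X, N)` induced by a morphism `M ⟶ N`. -/
def H.map {M N : X.Modules} (φ : M ⟶ N) (n : ℕ) : H M n →+ H N n :=
  Sheaf.H.map ((SheafOfModules.toSheaf X.ringCatSheaf).map φ) n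

lemma H.map_id {M : X.Modules} (n : ℕ) (x : H M n) : H.map (𝟙 M) n x = x :=
  Sheaf.H.map_id_apply x

lemma H.map_add {M N : X.Modules} (φ ψ : M ⟶ N) (n : ℕ) (x : H M n) :
    H.map (φ + ψ) n x = H.map φ n x + H.map ψ n x :=
  Sheaf.H.map_add_apply ((SheafOfModules.toSheaf X.ringCatSheaf).map φ)
    ((SheafOfModules.toSheaf X.ringCatSheaf).map ψ) x

lemma H.map_comp {M N P : X.Modules} (φ : M ⟶ N) (ψ : N ⟶ P) (n : ℕ) (x : H M n) :
    H.map (φ ≫ ψ) n x = H.map ψ n (H.map φ n x) :=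
  Sheaf.H.map_comp_apply ((SheafOfModules.toSheaf X.ringCatSheaf).map φ)
    ((SheafOfModules.toSheaf X.ringCatSheaf).map ψ) x

/-- The sections `e₁, …, e_r` of `M` over `V` form a frame: they trivialise `M|_V ≅ 𝒪_V^r`. -/
def IsFrame (M : X.Modules) {r : ℕ} (V : X.Opens) (e : Fin r → Γ(M, V)) : Prop :=
  ∀ (W : X.Opens) (h : W ≤ V), Function.Bijective
    fun c : Fin r → Γ(X, W) ↦ ∑ i, c i • resSec M h (e i)

/-- `M` is locally free of rank `r`. -/
def IsLocallyFreeOfRank (M : X.Modules) (r : ℕ) : Prop :=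
  ∀ x : X, ∃ V : X.Opens, x ∈ V ∧ ∃ e : Fin r → Γ(M, V), IsFrame M V e

/-- Coherent sheaves on a (locally noetherian) scheme. -/
structure IsCoherent (M : X.Modules) : Prop where
  quasicoherent : SheafOfModules.IsQuasicoherent (R := X.ringCatSheaf) M
  finite : ∀ U : X.Opens, IsAffineOpen U → Module.Finite Γ(X, U) Γ(M, U)

/-- Torsion-free sheaves on an integral scheme. -/
def IsTorsionFree (M : X.Modules) : Prop :=
  ∀ (U : X.Opens) (f : Γ(X, U)) (s : Γ(M, U)), f ≠ 0 → f • s = 0 → s = 0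

/-- On the open set `U` the sheaf `M` is locally free of rank `r` and its determinant
`⋀ʳ M|_U` is identified with `L|_U`: there is an `𝒪_U`-multilinear alternating map
`M|_U × ⋯ × M|_U → L|_U` which sends the members of suitable local frames of `M`
to a local generator of `L`. -/
def HasDeterminantOn (M : X.Modules) (r : ℕ) (L : X.Modules) (U : X.Opens) : Prop :=
  ∃ ω : ∀ V : X.Opens, V ≤ U → Γ(M, V) [⋀^Fin r]→ₗ[Γ(X, V)] Γ(L, V),
    (∀ (V W : X.Opens) (hV : V ≤ U) (hW : W ≤ V) (m : Fin r → Γ(M, V)),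
      resSec L hW (ω V hV m) = ω W (hW.trans hV) fun i ↦ resSec M hW (m i)) ∧
    ∀ x ∈ U, ∃ (V : X.Opens) (hV : V ≤ U), x ∈ V ∧
      ∃ e : Fin r → Γ(M, V), IsFrame M V e ∧ IsFrame L V fun _ : Fin 1 ↦ ω V hV e

/-- Multiplication by a global function, as an endomorphism of a sheaf of modules. -/
def mulGlobal (M : X.Modules) (f : Γ(X, ⊤)) : M ⟶ M :=
  ⟨PresheafOfModules.homMk (M₁ := M.val) (M₂ := M.val)
    { app := fun U ↦ AddCommGrpCat.ofHom
        (DistribSMul.toAddMonoidHom Γ(M, U.unop) (resFun (le_top : U.unop ≤ ⊤) f))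
      naturality := fun U V i ↦ by
        ext (s : Γ(M, U.unop))
        have h := M.map_smul i.unop (resFun (le_top : U.unop ≤ ⊤) f) s
        rw [← CommRingCat.comp_apply, ← Functor.map_comp] at h
        exact h.symm }
    fun U r m ↦ smul_comm (M := Γ(X, U.unop)) (N := Γ(X, U.unop)) (α := Γ(M, U.unop)) _ _ _⟩

lemma mulGlobal_app (M : X.Modules) (f : Γ(X, ⊤)) (U : X.Opens) (s : Γ(M, U)) :
    (mulGlobal M f).app U s = resFun (le_top : U ≤ ⊤) f • s := rfl

lemma mulGlobal_one (M : X.Modules) : mulGlobal M 1 = 𝟙 M := by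
  ext U s
  rw [mulGlobal_app]
  simp [resFun]

lemma mulGlobal_mul (M : X.Modules) (f g : Γ(X, ⊤)) :
    mulGlobal M (f * g) = mulGlobal M g ≫ mulGlobal M f := by
  ext U s
  rw [Scheme.Modules.Hom.comp_app, CategoryTheory.comp_apply]
  simp only [mulGlobal_app]
  rw [resFun, map_mul, mul_smul]

lemma mulGlobal_add (M : X.Modules) (f g : Γ(X, ⊤)) :
    mulGlobal M (f + g) = mulGlobal M f + mulGlobal M g := by
  ext U s
  rw [Scheme.Modules.Hom.add_app, mulGlobal_app, resFun, map_add, add_smul]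
  rfl

/-- The action of the ring of global functions on cohomology, by functoriality. -/
def globalActionH (M : X.Modules) (n : ℕ) : Γ(X, ⊤) →+* AddMonoid.End (H M n) :=
  RingHom.mk'
    { toFun := fun f ↦ H.map (mulGlobal M f) n
      map_one' := by
        rw [mulGlobal_one]
        exact AddMonoidHom.ext (H.map_id n)
      map_mul' := fun f g ↦ by
        rw [mulGlobal_mul]
        exact AddMonoidHom.ext (H.map_comp _ _ n) }
    (fun f g ↦ by
      change H.map (mulGlobal M (f + g)) n = _
      rw [mulGlobal_add]
      exact AddMonoidHom.ext (H.map_add _ _ n))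

/-- `dim_ℂ Hⁿ(X, M)` for a scheme `p : X ⟶ Spec ℂ` over the complex numbers
(and `0` if this is infinite). -/
def hdim (p : X ⟶ Spec (.of ℂ)) (M : X.Modules) (n : ℕ) : ℕ :=
  letI : Module ℂ (H M n) :=
    Module.compHom (H M n)
      ((globalActionH M n).comp ((Scheme.ΓSpecIso (.of ℂ)).inv ≫ p.appTop).hom)
  Module.finrank ℂ (H M n)

lemma resFun_resFun {U V W : X.Opens} (h : V ≤ U) (h' : W ≤ V) (f : Γ(X, U)) :
    resFun h' (resFun h f) = resFun (h'.trans h) f := by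
  simp only [resFun]
  rw [← CommRingCat.comp_apply, ← Functor.map_comp]
  rfl

lemma resFun_mul {U V : X.Opens} (h : V ≤ U) (f g : Γ(X, U)) :
    resFun h (f * g) = resFun h f * resFun h g :=
  map_mul _ f g

end Modules

/-! ### Gluing line bundles from transition functions -/

section Glue

variable {X : Scheme.{0}} {ι : Type} (U : ι → X.Opens) (g : ∀ i j, Γ(X, U i ⊓ U j))

/-- The `𝒪_X(W)`-module `∏ᵢ 𝒪_X(W ∩ Uᵢ)`. -/
abbrev piModule (W : X.Opens) : Module Γ(X, W) (∀ i, Γ(X, W ⊓ U i)) :=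
  Module.compHom _ (RingHom.pi fun i ↦
    (X.presheaf.map (homOfLE (inf_le_left : W ⊓ U i ≤ W)).op).hom)

/-- The sections over `W` of the sheaf glued from the trivial line bundles on the `Uᵢ` by means of
the transition functions `gᵢⱼ`: families `sᵢ ∈ 𝒪_X(W ∩ Uᵢ)` with `sᵢ = gᵢⱼ sⱼ` on
`W ∩ Uᵢ ∩ Uⱼ`. -/
def gluedSections (W : X.Opens) :
    letI := piModule U W
    Submodule Γ(X, W) (∀ i, Γ(X, W ⊓ U i)) :=
  letI := piModule U W
  { carrier := {s | ∀ i j,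
      resFun (inf_le_inf_left W inf_le_left : W ⊓ (U i ⊓ U j) ≤ W ⊓ U i) (s i) =
        resFun (inf_le_right : W ⊓ (U i ⊓ U j) ≤ U i ⊓ U j) (g i j) *
          resFun (inf_le_inf_left W inf_le_right : W ⊓ (U i ⊓ U j) ≤ W ⊓ U j) (s j)}
    add_mem' := fun {s t} hs ht i j ↦ by
      simp only [Pi.add_apply, resFun, map_add, mul_add]
      exact congr_arg₂ (· + ·) (hs i j) (ht i j)
    zero_mem' := fun i j ↦ by simp [resFun]
    smul_mem' := fun f s hs i j ↦ by
      change resFun _ (resFun inf_le_left f * s i) = _ * resFun _ (resFun inf_le_left f * s j)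
      have h := hs i j
      simp only [resFun, map_mul] at h ⊢
      rw [h]
      change resFun _ (resFun _ f) * _ = _ * (resFun _ (resFun _ f) * _)
      rw [resFun_resFun, resFun_resFun]
      ring }

/-- The presheaf of abelian groups underlying `gluedLine`. -/
def gluedPresheaf : TopCat.Presheaf Ab X where
  obj W := .of (gluedSections U g W.unop)
  map {W W'} f := AddCommGrpCat.ofHom
    { toFun := fun s ↦ ⟨fun i ↦ resFun (inf_le_inf_right _ f.unop.le) (s.1 i), fun i j ↦ by
        have h := congr_arg (resFun (inf_le_inf_right _ f.unop.le :
          W'.unop ⊓ (U i ⊓ U j) ≤ W.unop ⊓ (U i ⊓ U j))) (s.2 i j)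
        rw [resFun_mul] at h
        simp only [resFun_resFun] at h ⊢
        exact h⟩
      map_zero' := Subtype.ext (funext fun i ↦ map_zero _)
      map_add' := fun s t ↦ Subtype.ext (funext fun i ↦ map_add _ _ _) }
  map_id W := by
    refine AddCommGrpCat.hom_ext (AddMonoidHom.ext fun s ↦ Subtype.ext (funext fun i ↦ ?_))
    exact ConcreteCategory.congr_hom (X.presheaf.map_id _) _
  map_comp f f' := by
    refine AddCommGrpCat.hom_ext (AddMonoidHom.ext fun s ↦ Subtype.ext (funext fun i ↦ ?_))
    exact (resFun_resFun (inf_le_inf_right _ f.unop.le) (inf_le_inf_right _ f'.unop.le) _).symm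

lemma gluedPresheaf_isSheaf : (gluedPresheaf U g).IsSheaf := by
  rw [TopCat.Presheaf.isSheaf_iff_isSheaf_comp (CategoryTheory.forget Ab)]
  refine TopCat.Presheaf.isSheaf_of_isSheafUniqueGluing_types _ fun κ V sf hsf ↦ ?_
  change ∀ k, gluedSections U g (V k) at sf
  have hcov (O : X.Opens) : iSup V ⊓ O ≤ ⨆ k, V k ⊓ O := by rw [iSup_inf_eq]
  have hle (O : X.Opens) (k : κ) : V k ⊓ O ≤ iSup V ⊓ O := inf_le_inf_right _ (le_iSup V k)
  have hcompat (i : ι) : TopCat.Presheaf.IsCompatible X.sheaf.obj (fun k ↦ V k ⊓ U i)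
      (fun k ↦ (sf k).1 i) := by
    intro k l
    have h := congr_fun (congr_arg Subtype.val (hsf k l)) i
    change resFun _ _ = resFun _ _ at h
    have h' := congr_arg (resFun (le_inf (inf_le_inf inf_le_left inf_le_left)
      (inf_le_left.trans inf_le_right) :
        (V k ⊓ U i) ⊓ (V l ⊓ U i) ≤ (V k ⊓ V l) ⊓ U i)) h
    rw [resFun_resFun, resFun_resFun] at h'
    exact h'
  choose s hs hs' using fun i ↦ X.sheaf.existsUnique_gluing' (fun k ↦ V k ⊓ U i)
    (iSup V ⊓ U i) (fun k ↦ homOfLE (hle _ k)) (hcov _) _ (hcompat i)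
  have hs (i : ι) (k : κ) : resFun (hle _ k) (s i) = (sf k).1 i := hs i k
  refine ⟨⟨s, fun i j ↦ ?_⟩, fun k ↦ ?_, fun t ht ↦ ?_⟩
  · refine X.sheaf.eq_of_locally_eq' (fun k ↦ V k ⊓ (U i ⊓ U j)) _
      (fun k ↦ homOfLE (hle _ k)) (hcov _) _ _ fun k ↦ ?_
    have h := (sf k).2 i j
    rw [← hs i k, ← hs j k] at h
    refine Eq.trans ?_ (h.trans ?_)
    · refine (resFun_resFun _ (hle _ k) _).trans (resFun_resFun _ _ _).symm
    · refine Eq.trans ?_ (resFun_mul (hle _ k) _ _).symm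
      rw [resFun_resFun]
      refine congr_arg₂ (· * ·) rfl ?_
      exact (resFun_resFun _ _ _).trans (resFun_resFun _ (hle _ k) _).symm
  · exact Subtype.ext (funext fun i ↦ hs i k)
  · refine Subtype.ext (funext fun i ↦ hs' i _ fun k ↦ ?_)
    exact congr_fun (congr_arg Subtype.val (ht k)) i

instance (W : X.Opensᵒᵖ) :
    Module (X.ringCatSheaf.obj.obj W) ((gluedPresheaf U g).obj W) :=
  letI := piModule U W.unop
  inferInstanceAs (Module Γ(X, W.unop) (gluedSections U g W.unop))

/-- The sheaf of modules obtained by gluing the trivial line bundles on the open sets `Uᵢ` along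
the transition functions `gᵢⱼ`. -/
def gluedLine : X.Modules where
  val := PresheafOfModules.ofPresheaf (gluedPresheaf U g) fun W W' f r s ↦ by
    refine Subtype.ext (funext fun i ↦ ?_)
    refine (resFun_mul (inf_le_inf_right _ f.unop.le) _ _).trans ?_
    refine congr_arg₂ (· * ·) ?_ rfl
    exact (resFun_resFun inf_le_left (inf_le_inf_right _ f.unop.le) r).trans
      (resFun_resFun f.unop.le inf_le_left r).symm
  isSheaf := gluedPresheaf_isSheaf U g

end Glue

/-! ### Projective space -/

section ProjectiveSpace

open MvPolynomial

attribute [local instance] MvPolynomial.gradedAlgebra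

/-- `ℙⁿ` over the complex numbers, with homogeneous coordinates indexed by `Fin (n + 1)`. -/
def PP (n : ℕ) : Scheme.{0} := Proj (homogeneousSubmodule (Fin (n + 1)) ℂ)

/-- The structure morphism of `ℙⁿ`. -/
def PP.toSpec (n : ℕ) : PP n ⟶ Spec (.of ℂ) :=
  Proj.toSpecZero (homogeneousSubmodule (Fin (n + 1)) ℂ) ≫
    Spec.map (CommRingCat.ofHom (algebraMap ℂ (homogeneousSubmodule (Fin (n + 1)) ℂ 0)))

/-- The standard affine chart `{x_k ≠ 0}` of `ℙⁿ`. -/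
def PP.chart (n : ℕ) (k : Fin (n + 1)) : (PP n).Opens :=
  Proj.basicOpen (homogeneousSubmodule (Fin (n + 1)) ℂ) (X k)

/-- The function `x_j / x_k` on the chart `{x_k ≠ 0}` of `ℙⁿ`. -/
def PP.ratio (n : ℕ) (j k : Fin (n + 1)) : Γ(PP n, PP.chart n k) :=
  Proj.awayToSection (homogeneousSubmodule (Fin (n + 1)) ℂ) (X k)
    (HomogeneousLocalization.Away.mk (homogeneousSubmodule (Fin (n + 1)) ℂ)
      (isHomogeneous_X ℂ k) 1 (X j) (by simpa using isHomogeneous_X ℂ j))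

end ProjectiveSpace

/-! ### The blow-up of `ℙ³` at the point `p₀ = [1 : 0 : 0 : 0]` -/

/-- The product `ℙ³ × ℙ²`. -/
def PPprod : Scheme.{0} := Limits.pullback (PP.toSpec 3) (PP.toSpec 2)

def PPprod.fst : PPprod ⟶ PP 3 := Limits.pullback.fst _ _

def PPprod.snd : PPprod ⟶ PP 2 := Limits.pullback.snd _ _

/-- The open set `{x_k ≠ 0, y_l ≠ 0}` of `ℙ³ × ℙ²`. -/
def PPprod.chart (k : Fin 4) (l : Fin 3) : PPprod.Opens :=
  PPprod.fst ⁻¹ᵁ PP.chart 3 k ⊓ PPprod.snd ⁻¹ᵁ PP.chart 2 l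

/-- The function `(x_a / x_k) (y_b / y_l)` on `{x_k ≠ 0, y_l ≠ 0}`. -/
def PPprod.monomial (k : Fin 4) (l : Fin 3) (a : Fin 4) (b : Fin 3) :
    Γ(PPprod, PPprod.chart k l) :=
  resFun inf_le_left (PPprod.fst.app _ (PP.ratio 3 a k)) *
    resFun inf_le_right (PPprod.snd.app _ (PP.ratio 2 b l))

/-- The closed subset of `ℙ³ × ℙ²` given by the equations `x_{i+1} y_j = x_{j+1} y_i`
(`i, j = 0, 1, 2`), i.e. by the condition that `y` is proportional to `(x₁, x₂, x₃)`. It is the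
closure of the graph of the linear projection of `ℙ³` from `p₀ = [1 : 0 : 0 : 0]` onto `ℙ²`. -/
def blowupLocus : Closeds PPprod :=
  (⨆ (k : Fin 4) (l : Fin 3) (i : Fin 3) (j : Fin 3),
    PPprod.basicOpen (PPprod.monomial k l i.succ j - PPprod.monomial k l j.succ i)).compl

/-- The blow-up `B` of `ℙ³` at the point `p₀ = [1 : 0 : 0 : 0]`, as the (reduced) closed subscheme
`{x_{i+1} y_j = x_{j+1} y_i}` of `ℙ³ × ℙ²`. -/
def B : Scheme.{0} := (Scheme.IdealSheafData.vanishingIdeal blowupLocus).subscheme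

def B.incl : B ⟶ PPprod := (Scheme.IdealSheafData.vanishingIdeal blowupLocus).subschemeι

/-- The blow-down map `π : B ⟶ ℙ³`. -/
def B.π : B ⟶ PP 3 := B.incl ≫ PPprod.fst

/-- The other projection `B ⟶ ℙ²`, which resolves the linear projection from `p₀`. -/
def B.pr : B ⟶ PP 2 := B.incl ≫ PPprod.snd

/-- The structure morphism of `B`. -/
def B.toSpec : B ⟶ Spec (.of ℂ) := B.π ≫ PP.toSpec 3

/-- The open sets `{x_k ≠ 0, y_l ≠ 0}` of `B`. -/
def B.chart (c : Fin 4 × Fin 3) : B.Opens := B.π ⁻¹ᵁ PP.chart 3 c.1 ⊓ B.pr ⁻¹ᵁ PP.chart 2 c.2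

/-- The function `x_j / x_k` on `{x_k ≠ 0, y_l ≠ 0}`, where `c = (k, l)`. -/
def B.xRatio (c : Fin 4 × Fin 3) (j : Fin 4) : Γ(B, B.chart c) :=
  resFun inf_le_left (B.π.app _ (PP.ratio 3 j c.1))

/-- The function `y_j / y_l` on `{x_k ≠ 0, y_l ≠ 0}`, where `c = (k, l)`. -/
def B.yRatio (c : Fin 4 × Fin 3) (j : Fin 3) : Γ(B, B.chart c) :=
  resFun inf_le_right (B.pr.app _ (PP.ratio 2 j c.2))

/-- The transition functions `(x_{k'} / x_k)^(p+q) (y_{l'} / y_l)^(-q)` on the intersection of the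
charts `(k, l)` and `(k', l')`. (Powers with a negative exponent are written as powers of the
inverse function.) -/
def B.transition (p q : ℤ) (c c' : Fin 4 × Fin 3) : Γ(B, B.chart c ⊓ B.chart c') :=
  resFun inf_le_left (B.xRatio c c'.1) ^ (p + q).toNat *
    resFun inf_le_right (B.xRatio c' c.1) ^ (-(p + q)).toNat *
    (resFun inf_le_left (B.yRatio c c'.2) ^ (-q).toNat *
      resFun inf_le_right (B.yRatio c' c.2) ^ q.toNat)

/-- The line bundle `𝒪_B(p, q) = 𝒪_B(pH + qE)`, where `H` is the pull-back of a plane and `E` is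
the exceptional divisor `π⁻¹(p₀)`. In the chart `(k, l)` the divisor `H` (the pull-back of the
plane `x₀ = 0`) has the local equation `x₀ / x_k` and the divisor `E` has the local
equation `x_{l+1} / x_k = (x_{l+1} / y_l) (y_l / x_k)`, where the ratio `x_{l+1} / y_l` does
not depend on `l`; so `𝒪_B(H)` has the transition functions `x_{k'} / x_k` and `𝒪_B(E)` has the
transition functions `(x_{k'} / x_k) (y_l / y_{l'})`. In other words
`𝒪_B(H) = π^* 𝒪(1)` and `𝒪_B(H - E) = pr^* 𝒪(1)`. -/
def B.O (p q : ℤ) : B.Modules := gluedLine B.chart (B.transition p q)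

/-- The twist `F(p, q) = F ⊗ 𝒪_B(p, q)`. -/
def twist (F : B.Modules) (p q : ℤ) : B.Modules := tensor F (B.O p q)

/-- The morphism `F(p, q) ⟶ G(p, q)` induced by `F ⟶ G`. -/
def twistMap {F G : B.Modules} (φ : F ⟶ G) (p q : ℤ) : twist F p q ⟶ twist G p q :=
  tensorMap φ (B.O p q)

/-! ### Slopes, stability and instanton sheaves -/

/-- The intersection number `D₁ · D₂ · D₃` of the divisor classes `Dᵢ = aᵢ H + bᵢ E` on `B`
(`H · E = 0` and `H³ = E³ = 1`); the pair `(a, b)` stands for the class `aH + bE`. -/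
def inter (D₁ D₂ D₃ : ℤ × ℤ) : ℤ := D₁.1 * D₂.1 * D₃.1 + D₁.2 * D₂.2 * D₃.2

/-- The polarization of `B`: the ample fundamental divisor class `2H - E = - K_B / 2`. -/
def polarization : ℤ × ℤ := (2, -1)

/-- The torsion-free coherent sheaf `F` on the smooth threefold `B` has rank `r` and first Chern
class `c₁(F) = D.1 H + D.2 E`: outside a closed subset of dimension at most `1` (that is, of
codimension at least `2`) the sheaf `F` is locally free of rank `r` and its determinant is
`𝒪_B(D)`. -/
def HasRankC1 (F : B.Modules) (r : ℕ) (D : ℤ × ℤ) : Prop :=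
  ∃ U : B.Opens, topologicalKrullDim ((U : Set B)ᶜ : Set B) ≤ 1 ∧
    HasDeterminantOn F r (B.O D.1 D.2) U

/-- The slope `c₁ · h² / r`, where `h` is the polarization. -/
def muSlope (r : ℕ) (D : ℤ × ℤ) : ℚ := inter D polarization polarization / r

/-- `μ`-stability of a torsion-free coherent sheaf: `μ(G) < μ(F)` for all coherent subsheaves
`G ⊆ F` with `0 < rk G < rk F`. -/
structure IsMuStable (F : B.Modules) : Prop where
  coherent : IsCoherent F
  torsionFree : IsTorsionFree F
  slope_lt : ∃ (r : ℕ) (D : ℤ × ℤ), 0 < r ∧ HasRankC1 F r D ∧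
    ∀ (G : B.Modules) (j : G ⟶ F), Mono j → IsCoherent G → ∀ (s : ℕ) (D' : ℤ × ℤ),
      HasRankC1 G s D' → 0 < s → s < r → muSlope s D' < muSlope r D

/-- `μ`-semistability of a torsion-free coherent sheaf: `μ(G) ≤ μ(F)` for all coherent subsheaves
`G ⊆ F` with `0 < rk G < rk F`. -/
structure IsMuSemistable (F : B.Modules) : Prop where
  coherent : IsCoherent F
  torsionFree : IsTorsionFree F
  slope_le : ∃ (r : ℕ) (D : ℤ × ℤ), 0 < r ∧ HasRankC1 F r D ∧
    ∀ (G : B.Modules) (j : G ⟶ F), Mono j → IsCoherent G → ∀ (s : ℕ) (D' : ℤ × ℤ),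
      HasRankC1 G s D' → 0 < s → s < r → muSlope s D' ≤ muSlope r D

/-- `F` is an instanton sheaf of rank `r`: a torsion-free semistable coherent sheaf with
`c₁(F) = 0`, subject to vanishing conditions on the cohomology. -/
structure IsInstanton (F : B.Modules) (r : ℕ) : Prop where
  semistable : IsMuSemistable F
  rank_c1 : HasRankC1 F r (0, 0)
  h0 : Subsingleton (H F 0)
  h3 : Subsingleton (H (twist F (-4) 1) 3)
  h1_middle : Subsingleton (H (twist F (-2) 1) 1)
  h2_middle : Subsingleton (H (twist F (-2) 1) 2)
  h2_E : Subsingleton (H (twist F 0 (-1)) 2)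
  h2_pr : Subsingleton (H (twist F (-1) 1) 2)

/-! ### Curves and elementary transformations -/

/-- The closed immersion `i : S ⟶ Y` is a locally complete intersection: locally on `Y` the ideal
of `S` is generated by a regular sequence. -/
def IsLci {S Y : Scheme.{0}} (i : S ⟶ Y) : Prop :=
  ∀ x : S, ∃ U : Y.Opens, IsAffineOpen U ∧ i x ∈ U ∧
    ∃ fs : List Γ(Y, U), RingTheory.Sequence.IsRegular Γ(Y, U) fs ∧
      RingHom.ker (i.app U).hom = Ideal.ofList fs

/-- `i : S ⟶ B` is an embedded, reduced, possibly reducible, locally complete intersection curve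
(a curve is non-empty and has pure dimension one). -/
structure IsLciCurve {S : Scheme.{0}} (i : S ⟶ B) : Prop where
  closedImmersion : IsClosedImmersion i
  reduced : IsReduced S
  nonempty : Nonempty S
  pure_dim : ∀ Z ∈ irreducibleComponents S, topologicalKrullDim Z = 1
  lci : IsLci i

/-- The structure sheaf as a sheaf of modules. -/
def structureSheaf (S : Scheme.{0}) : S.Modules := SheafOfModules.unit S.ringCatSheaf

/-- The Euler characteristic `h⁰ - h¹` of a coherent sheaf on a projective curve. -/
def curveChi {S : Scheme.{0}} (p : S ⟶ Spec (.of ℂ)) (M : S.Modules) : ℤ :=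
  (hdim p M 0 : ℤ) - hdim p M 1

/-- The arithmetic genus `g = 1 - χ(𝒪_S)` of a projective curve. -/
def genus {S : Scheme.{0}} (p : S ⟶ Spec (.of ℂ)) : ℤ := 1 - curveChi p (structureSheaf S)

/-- The (total) degree `χ(L) - χ(𝒪_S)` of a line bundle `L` on a projective curve. -/
def lineDegree {S : Scheme.{0}} (p : S ⟶ Spec (.of ℂ)) (L : S.Modules) : ℤ :=
  curveChi p L - curveChi p (structureSheaf S)

/-- The direct image `i_* L` of a sheaf on a subscheme of `B`. -/
def direct {S : Scheme.{0}} (i : S ⟶ B) (L : S.Modules) : B.Modules :=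
  (Scheme.Modules.pushforward i).obj L

/-- The triple `(i : S ⟶ B, L, φ)` is an elementary transformation datum for the sheaf `F`.
In the two surjectivity conditions `(i_* L)(2, -1)(-1, 1)` is `(i_* L)(1, 0)`, and
`(i_* L)(2, -1)(-1, 0)` is `(i_* L)(1, -1)`. -/
structure IsElementaryDatum (F : B.Modules) {S : Scheme.{0}} (i : S ⟶ B) (L : S.Modules)
    (φ : F ⟶ twist (direct i L) 2 (-1)) : Prop where
  curve : IsLciCurve i
  line : IsLocallyFreeOfRank L 1
  degree : lineDegree (i ≫ B.toSpec) L = genus (i ≫ B.toSpec) - 1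
  h0 : Subsingleton (H (direct i L) 0)
  h1 : Subsingleton (H (direct i L) 1)
  surj₁ : Function.Surjective (H.map (twistMap φ (-1) 1) 1)
  surj₂ : Function.Surjective (H.map (twistMap φ (-1) 0) 1)
  epi : Epi φ

/-- The elementary transform of `F` along `φ`. -/
def elementaryTransform {F Q : B.Modules} (φ : F ⟶ Q) : B.Modules := Limits.kernel φ

end

end InstantonBlowup

open InstantonBlowup

namespace InstantonBlowup

noncomputable section

/-! ### Sections of tensor products -/

section Tensor

variable {X : Scheme.{0}}

/-! The quotient of `E` by `F = ker φ` lives on a curve, which has codimension two in `B`. So `F`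
and `E` agree off that curve and share rank, first Chern class and slope. A coherent subsheaf of `F`
is also a subsheaf of `E`, with the same rank and class, and the strict slope inequality for `E` is
the one wanted for `F`.

Two points need work. For the class, a determinant of `E` on `U` restricts to a determinant of `F`
on `U` minus the curve (`HasDeterminantOn.of_bijective`), and the removed set still has dimension at
most one (`topologicalKrullDim_union_le`).

For coherence of `F`, full quasi-coherence of the target of `φ` is not needed. Its separatedness
half, `HasPowerTorsion`, suffices: a section vanishing on `D(f)` is locally killed by a power of
`f`. This property holds for line bundles and passes through quasi-compact direct images and twists
by line bundles. On an affine scheme it forces the kernel to localize correctly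
(`isIso_fromTildeΓ_of_exact`). Finite generation then follows because `B` is locally noetherian. -/

/-- The presheaf `U ↦ M(U) ⊗ N(U)`. -/
abbrev tensorPresheaf (M N : X.Modules) :
    PresheafOfModules (X.presheaf ⋙ forget₂ CommRingCat RingCat) :=
  MonoidalCategory.tensorObj
      (C := PresheafOfModules (X.presheaf ⋙ forget₂ CommRingCat RingCat)) M.val N.val

/-- The canonical map from `M(U) ⊗ N(U)` to the sections of `M ⊗ N` over `U`. -/
def toTensor (M N : X.Modules) (U : X.Opens) :
    TensorProduct Γ(X, U) Γ(M, U) Γ(N, U) →+ Γ(tensor M N, U) :=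
  ((CategoryTheory.toSheafify (Opens.grothendieckTopology X)
    (tensorPresheaf M N).presheaf).app (op U)).hom

open TensorProduct in
lemma resSec_toTensor (M N : X.Modules) {U V : X.Opens} (h : V ≤ U) (m : Γ(M, U)) (n : Γ(N, U)) :
    resSec (tensor M N) h (toTensor M N U (m ⊗ₜ n)) =
      toTensor M N V (resSec M h m ⊗ₜ resSec N h n) :=
  (ConcreteCategory.congr_hom ((CategoryTheory.toSheafify (Opens.grothendieckTopology X)
    (tensorPresheaf M N).presheaf).naturality (homOfLE h).op) (m ⊗ₜ[Γ(X, U)] n)).symm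

/-- `toTensor` is built from the sheafification of abelian groups. Linearity holds because the unit
of the sheafification of modules has the same underlying map. -/
lemma toTensor_smul (M N : X.Modules) (U : X.Opens) (f : Γ(X, U))
    (z : TensorProduct Γ(X, U) Γ(M, U) Γ(N, U)) :
    toTensor M N U (f • z) = f • toTensor M N U z :=
  (((PresheafOfModules.sheafificationAdjunction (𝟙 X.ringCatSheaf.obj)).unit.app
    (tensorPresheaf M N)).app (op U)).hom.map_smul f z

/-- Local surjectivity of sheafification. -/
lemma exists_toTensor (M N : X.Modules) {U : X.Opens} (t : Γ(tensor M N, U)) {x : X} (hx : x ∈ U) :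
    ∃ (V : X.Opens) (h : V ≤ U), x ∈ V ∧ ∃ z, toTensor M N V z = resSec (tensor M N) h t := by
  have := Presheaf.imageSieve_mem (Opens.grothendieckTopology X)
    (CategoryTheory.toSheafify (Opens.grothendieckTopology X) (tensorPresheaf M N).presheaf)
    (U := op U) t
  obtain ⟨V, i, ⟨z, hz⟩, hxV⟩ := this x hx
  exact ⟨V, i.le, hxV, z, hz⟩

-- Local injectivity of sheafification, for a pure tensor.
open TensorProduct in
lemma exists_tmul_eq_zero (M N : X.Modules) {U : X.Opens} (m : Γ(M, U)) (n : Γ(N, U))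
    (hz : toTensor M N U (m ⊗ₜ n) = 0) {x : X} (hx : x ∈ U) :
    ∃ (V : X.Opens) (h : V ≤ U), x ∈ V ∧ resSec M h m ⊗ₜ[Γ(X, V)] resSec N h n = 0 := by
  have := Presheaf.equalizerSieve_mem (Opens.grothendieckTopology X)
    (CategoryTheory.toSheafify (Opens.grothendieckTopology X) (tensorPresheaf M N).presheaf)
    (X := op U) (m ⊗ₜ[Γ(X, U)] n) 0 (hz.trans (map_zero (toTensor M N U)).symm)
  obtain ⟨V, i, hi, hxV⟩ := this x hx
  refine ⟨V, i.le, hxV, ?_⟩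
  exact Eq.trans hi (map_zero ((tensorPresheaf M N).presheaf.map i.op).hom)

end Tensor

/-! ### Modules with power torsion -/

section PowerTorsion

variable {X : Scheme.{0}}

lemma resSec_resSec (M : X.Modules) {U V W : X.Opens} (h : V ≤ U) (h' : W ≤ V) (s : Γ(M, U)) :
    resSec M h' (resSec M h s) = resSec M (h'.trans h) s :=
  (ConcreteCategory.congr_hom (M.presheaf.map_comp (homOfLE h).op (homOfLE h').op) s).symm

lemma resSec_smul (M : X.Modules) {U V : X.Opens} (h : V ≤ U) (f : Γ(X, U)) (s : Γ(M, U)) :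
    resSec M h (f • s) = resFun h f • resSec M h s :=
  M.map_smul (homOfLE h) f s

lemma app_resSec {M N : X.Modules} (φ : M ⟶ N) {U V : X.Opens} (h : V ≤ U) (s : Γ(M, U)) :
    φ.app V (resSec M h s) = resSec N h (φ.app U s) :=
  ConcreteCategory.congr_hom (φ.mapPresheaf.naturality (homOfLE h).op) s

/-- A section which vanishes locally is zero. -/
lemma eq_zero_of_locally (M : X.Modules) {U : X.Opens} (s : Γ(M, U))
    (hs : ∀ x ∈ U, ∃ (V : X.Opens) (h : V ≤ U), x ∈ V ∧ resSec M h s = 0) : s = 0 := by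
  choose! V hV hxV hV0 using hs
  refine TopCat.Sheaf.eq_of_locally_eq' ⟨M.presheaf, M.isSheaf⟩ (fun x : U ↦ V x.1) U
    (fun x ↦ homOfLE (hV x.1 x.2)) (fun x hx ↦ ?_) s 0 fun x ↦ ?_
  · exact Opens.mem_iSup.2 ⟨⟨x, hx⟩, hxV x hx⟩
  · exact (hV0 x.1 x.2).trans (map_zero (M.presheaf.map _).hom).symm

lemma basicOpen_resFun_le {U V : X.Opens} (h : V ≤ U) (f : Γ(X, U)) :
    X.basicOpen (resFun h f) ≤ X.basicOpen f := by
  rw [resFun, Scheme.basicOpen_res]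
  exact inf_le_right

/-- A section of `M` that vanishes where `f` does not vanish is locally killed by a power of
`f`. -/
def HasPowerTorsion (M : X.Modules) : Prop :=
  ∀ (U : X.Opens) (f : Γ(X, U)) (t : Γ(M, U)), resSec M (X.basicOpen_le f) t = 0 →
    ∀ x ∈ U, ∃ (V : X.Opens) (h : V ≤ U), x ∈ V ∧ ∃ n : ℕ, resFun h f ^ n • resSec M h t = 0

/-- Compactness leaves finitely many local exponents, and their maximum works on all of `U`. -/
lemma HasPowerTorsion.exists_pow_smul_eq_zero {M : X.Modules} (hM : HasPowerTorsion M)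
    {U : X.Opens} (hU : IsCompact (U : Set X)) (f : Γ(X, U)) (t : Γ(M, U))
    (ht : resSec M (X.basicOpen_le f) t = 0) : ∃ n : ℕ, f ^ n • t = 0 := by
  choose! V hV hxV n hn using hM U f t ht
  obtain ⟨s, hs⟩ := hU.elim_finite_subcover (fun x : U ↦ (V x.1 : Set X)) (fun x ↦ (V x.1).2)
    fun x hx ↦ Set.mem_iUnion.2 ⟨⟨x, hx⟩, hxV x hx⟩
  refine ⟨s.sup fun x ↦ n x.1, eq_zero_of_locally M _ fun x hx ↦ ?_⟩
  obtain ⟨y, hy, hxy⟩ := Set.mem_iUnion₂.1 (hs hx)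
  refine ⟨V y.1, hV y.1 y.2, hxy, ?_⟩
  have hle : n y.1 ≤ s.sup fun x ↦ n x.1 := Finset.le_sup (f := fun x : U ↦ n x.1) hy
  rw [resSec_smul, resFun, map_pow, ← Nat.sub_add_cancel hle, pow_add, mul_smul, hn y.1 y.2,
    smul_zero]

lemma resSec_basicOpen_resFun (M : X.Modules) {U V : X.Opens} (h : V ≤ U) (f : Γ(X, U))
    (t : Γ(M, U)) (ht : resSec M (X.basicOpen_le f) t = 0) :
    resSec M (X.basicOpen_le (resFun h f)) (resSec M h t) = 0 := by
  rw [resSec_resSec, ← resSec_resSec M (X.basicOpen_le f) (basicOpen_resFun_le h f), ht]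
  exact map_zero _

/-- Line bundles have power torsion. -/
lemma IsLocallyFreeOfRank.hasPowerTorsion {M : X.Modules} (hM : IsLocallyFreeOfRank M 1) :
    HasPowerTorsion M := by
  intro U f t ht x hx
  obtain ⟨V, hxV, e, he⟩ := hM x
  obtain ⟨W, hWaff, hxW, hWle⟩ :=
    Opens.isBasis_iff_nbhd.1 X.isBasis_affineOpens (show x ∈ U ⊓ V from ⟨hx, hxV⟩)
  have hWU : W ≤ U := fun y hy ↦ (hWle hy).1
  have hWV : W ≤ V := fun y hy ↦ (hWle hy).2
  obtain ⟨c, hc⟩ := (he W hWV).2 (resSec M hWU t)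
  simp only [Fin.sum_univ_one] at hc
  refine ⟨W, hWU, hxW, ?_⟩
  -- Freeness over `D(f)` moves the vanishing of `t` to its coefficient, which reduces the claim to
  -- the structure sheaf on an affine open.
  have hc0 : (X.presheaf.map (homOfLE (X.basicOpen_le (resFun hWU f))).op) (c 0) = 0 := by
    have h1 := resSec_basicOpen_resFun M hWU f t ht
    rw [← hc, resSec_smul, resSec_resSec] at h1
    have := (he _ ((X.basicOpen_le (resFun hWU f)).trans hWV)).1
      (a₁ := fun _ ↦ resFun (X.basicOpen_le (resFun hWU f)) (c 0)) (a₂ := 0) (by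
        simpa using h1)
    exact congr_fun this 0
  obtain ⟨n, hn⟩ := exists_pow_mul_eq_zero_of_res_basicOpen_eq_zero_of_isCompact X
    (IsAffineOpen.isCompact hWaff) (c 0) (resFun hWU f) hc0
  exact ⟨n, by rw [← hc, ← mul_smul, hn, zero_smul]⟩

/-- Power torsion is preserved by direct images under quasi-compact morphisms. -/
lemma HasPowerTorsion.pushforward {Y : Scheme.{0}} (i : X ⟶ Y) [QuasiCompact i] {M : X.Modules}
    (hM : HasPowerTorsion M) : HasPowerTorsion ((Scheme.Modules.pushforward i).obj M) := by
  intro U f t ht x hx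
  obtain ⟨W, hW, hxW, hWle⟩ := Opens.isBasis_iff_nbhd.1 Y.isBasis_affineOpens hx
  refine ⟨W, hWle, hxW, ?_⟩
  -- Neighbourhoods in the source need not come from the target, so one exponent is needed on all of
  -- `i⁻¹ W`. This set is compact because `W` is affine.
  obtain ⟨n, hn⟩ := hM.exists_pow_smul_eq_zero (U := i ⁻¹ᵁ W)
    (i.isCompact_preimage (IsAffineOpen.isCompact hW)) (i.app W (resFun hWle f))
    (resSec ((Scheme.Modules.pushforward i).obj M) hWle t) (by
      have := resSec_basicOpen_resFun _ hWle f t ht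
      have hle : X.basicOpen (i.app W (resFun hWle f)) ≤ i ⁻¹ᵁ Y.basicOpen (resFun hWle f) := by
        rw [Scheme.preimage_basicOpen]
      have h2 := congr_arg (resSec M hle) this
      exact (resSec_resSec M _ hle _).symm.trans (h2.trans (map_zero _)))
  refine ⟨n, ?_⟩
  rw [← map_pow] at hn
  exact hn

open TensorProduct in
/-- If `n` is a free generator of the module `N`, then `m ↦ m ⊗ n` identifies `M` with
`M ⊗ N`. -/
lemma bijective_tmul {R M N : Type*} [CommRing R] [AddCommGroup M] [AddCommGroup N] [Module R M]
    [Module R N] (n : N) (hn : Function.Bijective fun r : R ↦ r • n) :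
    Function.Bijective fun m : M ↦ m ⊗ₜ[R] n := by
  let e : R ≃ₗ[R] N := LinearEquiv.ofBijective (LinearMap.toSpanSingleton R N n) hn
  have he : e 1 = n := one_smul R n
  convert ((TensorProduct.rid R M).symm ≪≫ₗ TensorProduct.congr (.refl R M) e).bijective using 1
  ext m
  simp [he]

lemma IsFrame.bijective_smul {N : X.Modules} {V : X.Opens} {e : Fin 1 → Γ(N, V)}
    (he : IsFrame N V e) {W : X.Opens} (h : W ≤ V) :
    Function.Bijective fun c : Γ(X, W) ↦ c • resSec N h (e 0) := by
  have := (he W h).comp (Equiv.funUnique (Fin 1) Γ(X, W)).symm.bijective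
  convert this using 1
  ext c
  simp

open TensorProduct in
/-- Tensoring with a line bundle preserves power torsion. -/
lemma HasPowerTorsion.tensor {M N : X.Modules} (hM : HasPowerTorsion M)
    (hN : IsLocallyFreeOfRank N 1) : HasPowerTorsion (tensor M N) := by
  intro U f t ht x hx
  obtain ⟨V, hxV, e, he⟩ := hN x
  obtain ⟨W, hWUV, hxW, z, hz⟩ := exists_toTensor M N
    (resSec (InstantonBlowup.tensor M N) (inf_le_left : U ⊓ V ≤ U) t) (x := x) ⟨hx, hxV⟩
  have hWU : W ≤ U := hWUV.trans inf_le_left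
  have hWV : W ≤ V := hWUV.trans inf_le_right
  rw [resSec_resSec] at hz
  -- Against a generator of `N` every tensor is pure, so power torsion of `M` can be applied to `m`.
  obtain ⟨m, rfl⟩ := (bijective_tmul (M := Γ(M, W)) _ (he.bijective_smul hWV)).2 z
  have hm : resSec M (X.basicOpen_le (resFun hWU f)) m = 0 := by
    have h := resSec_basicOpen_resFun _ hWU f t ht
    rw [← hz, resSec_toTensor] at h
    refine eq_zero_of_locally M _ fun y hy ↦ ?_
    -- The tensor vanishes only in the sheafification. It vanishes in the presheaf after shrinking,
    -- and there the generator of `N` cancels.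
    obtain ⟨W', hW', hyW', h0⟩ := exists_tmul_eq_zero M N _ _ h hy
    refine ⟨W', hW', hyW', ?_⟩
    rw [resSec_resSec N, resSec_resSec N] at h0
    exact (bijective_tmul (M := Γ(M, W')) _
      (he.bijective_smul ((hW'.trans (X.basicOpen_le (resFun hWU f))).trans hWV))).1
      (h0.trans (TensorProduct.zero_tmul _ _).symm)
  obtain ⟨W', hW', hxW', n, hn⟩ := hM W (resFun hWU f) m hm x hxW
  refine ⟨W', hW'.trans hWU, hxW', n, ?_⟩
  rw [← resSec_resSec _ hWU hW', ← hz, resSec_toTensor, ← toTensor_smul, TensorProduct.smul_tmul',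
    ← resFun_resFun hWU hW', hn, TensorProduct.zero_tmul, map_zero]

/-- The tensor product `M ⊗ N` vanishes on every open set on which `M` vanishes. -/
lemma subsingleton_tensor {M N : X.Modules} {U : X.Opens}
    (hM : ∀ V ≤ U, Subsingleton Γ(M, V)) : Subsingleton Γ(tensor M N, U) := by
  refine subsingleton_of_forall_eq 0 fun t ↦ eq_zero_of_locally _ t fun x hx ↦ ?_
  obtain ⟨V, hV, hxV, z, hz⟩ := exists_toTensor M N t hx
  have := hM V hV
  refine ⟨V, hV, hxV, ?_⟩
  rw [← hz, Subsingleton.elim z 0, map_zero]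

end PowerTorsion

/-! ### The line bundles `𝒪_B(p, q)` -/

section Glue

lemma resFun_self {X : Scheme.{0}} {U : X.Opens} (h : U ≤ U) (f : Γ(X, U)) : resFun h f = f :=
  ConcreteCategory.congr_hom (X.presheaf.map_id (op U)) f

variable {X : Scheme.{0}} {ι : Type} {U : ι → X.Opens} {g : ∀ i j, Γ(X, U i ⊓ U j)}

/-- The module glued from transition functions which satisfy the cocycle conditions, over open
sets that cover `X`, is a line bundle. -/
lemma isLocallyFreeOfRank_gluedLine (hU : ∀ x : X, ∃ i, x ∈ U i) (hg : ∀ i, g i i = 1)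
    (hgc : ∀ i j k, resFun (inf_le_inf_right (U k) inf_le_left : U i ⊓ U j ⊓ U k ≤ U i ⊓ U k)
        (g i k) =
      resFun (inf_le_left : U i ⊓ U j ⊓ U k ≤ U i ⊓ U j) (g i j) *
        resFun (inf_le_inf_right (U k) inf_le_right : U i ⊓ U j ⊓ U k ≤ U j ⊓ U k) (g j k)) :
    IsLocallyFreeOfRank (gluedLine U g) 1 := by
  intro x
  obtain ⟨k, hk⟩ := hU x
  -- The generator over `U k` is `1` in chart `k`, hence `g i k` in chart `i`; the cocycle condition
  -- makes it a glued section.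
  let e : Γ(gluedLine U g, U k) := show gluedSections U g (U k) from
    ⟨fun i ↦ resFun (le_inf inf_le_right inf_le_left) (g i k), fun i j ↦ by
      have := congr_arg (resFun (le_inf inf_le_right inf_le_left :
        U k ⊓ (U i ⊓ U j) ≤ U i ⊓ U j ⊓ U k)) (hgc i j k)
      rw [resFun_mul] at this
      simpa only [resFun_resFun] using this⟩
  have key (W : X.Opens) (hW : W ≤ U k) (c : Fin 1 → Γ(X, W)) (i : ι) :
      Subtype.val (p := (· ∈ gluedSections U g W)) (∑ _j, c _j • resSec (gluedLine U g) hW e) i =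
        resFun inf_le_left (c 0) * resFun (le_inf inf_le_right (inf_le_left.trans hW)) (g i k) := by
    refine (congr_fun (congr_arg Subtype.val (Fin.sum_univ_one _)) i).trans ?_
    exact congr_arg (resFun (inf_le_left : W ⊓ U i ≤ W) (c 0) * ·) (resFun_resFun _ _ _)
  refine ⟨U k, hk, fun _ ↦ e, fun W hW ↦ ⟨fun a b hab ↦ ?_, fun s ↦ ?_⟩⟩
  · have h := congr_fun (congr_arg Subtype.val hab) k
    have h := (key W hW a k).symm.trans (h.trans (key W hW b k))
    simp only [hg, resFun, map_one, mul_one] at h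
    have h := congr_arg (resFun (le_inf le_rfl hW : W ≤ W ⊓ U k)) h
    erw [resFun_resFun, resFun_resFun] at h
    simp only [resFun_self] at h
    ext j
    rwa [Subsingleton.elim j 0]
  · change gluedSections U g W at s
    -- The coefficient is the coordinate of `s` in chart `k`; the gluing relation determines the
    -- others.
    refine ⟨fun _ ↦ resFun (le_inf le_rfl hW : W ≤ W ⊓ U k) (s.1 k), Subtype.ext (funext fun i ↦ ?_)⟩
    refine (key W hW _ i).trans ?_
    have h := congr_arg (resFun (le_inf inf_le_left (le_inf inf_le_right (inf_le_left.trans hW)) :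
      W ⊓ U i ≤ W ⊓ (U i ⊓ U k))) (s.2 i k)
    rw [resFun_mul] at h
    simp only [resFun_resFun, resFun_self] at h ⊢
    rw [h, mul_comm]

end Glue

/-! ### Cocycle identities for ratios of homogeneous coordinates -/

section Ratios

open MvPolynomial

attribute [local instance] MvPolynomial.gradedAlgebra

lemma PP.ratio_self (n : ℕ) (k : Fin (n + 1)) : PP.ratio n k k = 1 := by
  rw [PP.ratio]
  refine Eq.trans (congr_arg _ ?_) (map_one _)
  apply HomogeneousLocalization.val_injective
  refine (HomogeneousLocalization.Away.val_mk _ _ _ _ _).trans ?_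
  rw [HomogeneousLocalization.val_one]
  simp only [pow_one]
  exact Localization.mk_self (⟨X k, 1, pow_one _⟩ : Submonoid.powers (X k : MvPolynomial _ ℂ))

lemma PP.iSup_chart (n : ℕ) : ⨆ k, PP.chart n k = ⊤ := by
  refine Proj.iSup_basicOpen_eq_top' _ _ (fun i ↦ ⟨1, isHomogeneous_X ℂ i⟩) ?_
  refine top_le_iff.1 fun f _ ↦ ?_
  induction f using MvPolynomial.induction_on with
  | C a =>
    exact (Algebra.adjoin (homogeneousSubmodule (Fin (n + 1)) ℂ 0) _).algebraMap_mem
      ⟨C a, isHomogeneous_C _ a⟩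
  | add p q hp hq => exact add_mem (hp trivial) (hq trivial)
  | mul_X p i hp => exact mul_mem (hp trivial) (Algebra.subset_adjoin ⟨i, rfl⟩)

/-- Sections on `Proj` are families of elements of homogeneous localizations, so identities between
ratios can be checked point by point on fractions. -/
lemma PP.val_resFun_ratio (n : ℕ) (j k : Fin (n + 1)) {W : (PP n).Opens} (hk : W ≤ PP.chart n k)
    (x : W) :
    HomogeneousLocalization.val (Subtype.val (resFun hk (PP.ratio n j k)) x) =
      Localization.mk (X j) ⟨X k ^ 1, by rw [pow_one]; exact hk x.2⟩ := by
  rfl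

lemma PP.ratio_mul (n : ℕ) (j k l : Fin (n + 1)) {W : (PP n).Opens} (hk : W ≤ PP.chart n k)
    (hl : W ≤ PP.chart n l) :
    resFun hk (PP.ratio n j k) = resFun hk (PP.ratio n l k) * resFun hl (PP.ratio n j l) := by
  apply Subtype.ext
  funext x
  apply HomogeneousLocalization.val_injective
  refine (PP.val_resFun_ratio n j k hk x).trans (Eq.trans ?_
    ((HomogeneousLocalization.val_mul _ _).trans (congr_arg₂ (· * ·)
      (PP.val_resFun_ratio n l k hk x) (PP.val_resFun_ratio n j l hl x))).symm)
  rw [Localization.mk_mul, Localization.mk_eq_mk_iff, Localization.r_iff_exists]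
  refine ⟨1, ?_⟩
  simp only [Submonoid.coe_mul, OneMemClass.coe_one]
  ring

end Ratios

lemma B.exists_mem_chart (x : B) : ∃ c, x ∈ B.chart c := by
  obtain ⟨k, hk⟩ := Opens.mem_iSup.1
    ((PP.iSup_chart 3).ge (Opens.mem_top (B.π x)))
  obtain ⟨l, hl⟩ := Opens.mem_iSup.1
    ((PP.iSup_chart 2).ge (Opens.mem_top (B.pr x)))
  exact ⟨(k, l), hk, hl⟩

lemma resFun_app {X Y : Scheme.{0}} (f : X ⟶ Y) {U V : Y.Opens} (h : V ≤ U) (s : Γ(Y, U)) :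
    resFun (f.preimage_mono h) (f.app U s) = f.app V (resFun h s) :=
  (ConcreteCategory.congr_hom (f.naturality (homOfLE h).op) s).symm

lemma B.xRatio_self (c : Fin 4 × Fin 3) : B.xRatio c c.1 = 1 := by
  rw [B.xRatio, PP.ratio_self, map_one]
  exact map_one _

lemma B.yRatio_self (c : Fin 4 × Fin 3) : B.yRatio c c.2 = 1 := by
  rw [B.yRatio, PP.ratio_self, map_one]
  exact map_one _

lemma PP.pullback_ratio_mul {X : Scheme.{0}} (n : ℕ) (f : X ⟶ PP n) (j k l : Fin (n + 1))
    {W : X.Opens} (hk : W ≤ f ⁻¹ᵁ PP.chart n k) (hl : W ≤ f ⁻¹ᵁ PP.chart n l) :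
    resFun hk (f.app _ (PP.ratio n j k)) =
      resFun hk (f.app _ (PP.ratio n l k)) * resFun hl (f.app _ (PP.ratio n j l)) := by
  have hW : W ≤ f ⁻¹ᵁ (PP.chart n k ⊓ PP.chart n l) := le_inf hk hl
  have h := congr_arg (fun s ↦ resFun hW (f.app _ s))
    (PP.ratio_mul n j k l (inf_le_left : PP.chart n k ⊓ PP.chart n l ≤ _) inf_le_right)
  simp only [← resFun_app, map_mul, resFun_resFun] at h
  exact h

lemma B.xRatio_mul (c c' : Fin 4 × Fin 3) (j : Fin 4) {W : B.Opens} (hc : W ≤ B.chart c)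
    (hc' : W ≤ B.chart c') :
    resFun hc (B.xRatio c j) = resFun hc (B.xRatio c c'.1) * resFun hc' (B.xRatio c' j) := by
  have key (c : Fin 4 × Fin 3) (j : Fin 4) (hc : W ≤ B.chart c) : resFun hc (B.xRatio c j) =
      resFun (hc.trans inf_le_left) (B.π.app _ (PP.ratio 3 j c.1)) := resFun_resFun _ hc _
  rw [key, key, key]
  exact PP.pullback_ratio_mul 3 B.π j c.1 c'.1 (hc.trans inf_le_left) (hc'.trans inf_le_left)

lemma B.yRatio_mul (c c' : Fin 4 × Fin 3) (j : Fin 3) {W : B.Opens} (hc : W ≤ B.chart c)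
    (hc' : W ≤ B.chart c') :
    resFun hc (B.yRatio c j) = resFun hc (B.yRatio c c'.2) * resFun hc' (B.yRatio c' j) := by
  have key (c : Fin 4 × Fin 3) (j : Fin 3) (hc : W ≤ B.chart c) : resFun hc (B.yRatio c j) =
      resFun (hc.trans inf_le_right) (B.pr.app _ (PP.ratio 2 j c.2)) := resFun_resFun _ hc _
  rw [key, key, key]
  exact PP.pullback_ratio_mul 2 B.pr j c.2 c'.2 (hc.trans inf_le_right) (hc'.trans inf_le_right)

lemma B.resFun_transition (p q : ℤ) (c c' : Fin 4 × Fin 3) {W : B.Opens} (hc : W ≤ B.chart c)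
    (hc' : W ≤ B.chart c') :
    resFun (le_inf hc hc') (B.transition p q c c') =
      resFun hc (B.xRatio c c'.1) ^ (p + q).toNat * resFun hc' (B.xRatio c' c.1) ^ (-(p + q)).toNat *
        (resFun hc (B.yRatio c c'.2) ^ (-q).toNat * resFun hc' (B.yRatio c' c.2) ^ q.toNat) := by
  rw [B.transition]
  simp only [resFun, map_mul, map_pow]
  simp only [resFun_resFun]

/-- Each of the four factors of a transition function is a natural power of a forward or backward
ratio and satisfies the cocycle condition by itself. No case distinction on the signs of `p + q` and
`q` is needed. -/
lemma B.isLocallyFreeOfRank_O (p q : ℤ) : IsLocallyFreeOfRank (B.O p q) 1 := by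
  refine isLocallyFreeOfRank_gluedLine B.exists_mem_chart (fun c ↦ ?_) fun i j k ↦ ?_
  · rw [B.transition, B.xRatio_self, B.yRatio_self]
    simp only [resFun, map_one, one_pow, mul_one]
  · have hi : B.chart i ⊓ B.chart j ⊓ B.chart k ≤ B.chart i := inf_le_left.trans inf_le_left
    have hj : B.chart i ⊓ B.chart j ⊓ B.chart k ≤ B.chart j := inf_le_left.trans inf_le_right
    have hk : B.chart i ⊓ B.chart j ⊓ B.chart k ≤ B.chart k := inf_le_right
    refine (B.resFun_transition p q i k hi hk).trans (Eq.trans ?_ (congr_arg₂ (· * ·)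
      (B.resFun_transition p q i j hi hj) (B.resFun_transition p q j k hj hk)).symm)
    rw [B.xRatio_mul i j k.1 hi hj, B.xRatio_mul k j i.1 hk hj, B.yRatio_mul i j k.2 hi hj,
      B.yRatio_mul k j i.2 hk hj]
    simp only [mul_pow]
    ring

/-! ### Noetherianity of `B` -/

section Noetherian

open MvPolynomial

attribute [local instance] MvPolynomial.gradedAlgebra

instance PP.locallyOfFiniteType_toSpec (n : ℕ) : LocallyOfFiniteType (PP.toSpec n) := by
  let 𝒜 := homogeneousSubmodule (Fin (n + 1)) ℂ
  have : IsScalarTower ℂ (𝒜 0) (MvPolynomial (Fin (n + 1)) ℂ) :=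
    .of_algebraMap_eq (R := ℂ) (S := 𝒜 0) fun _ ↦ rfl
  have : Algebra.FiniteType (𝒜 0) (MvPolynomial (Fin (n + 1)) ℂ) :=
    .of_restrictScalars_finiteType ℂ (𝒜 0) _
  -- Homogeneous polynomials of degree zero are constants.
  have h : Function.Surjective (algebraMap ℂ (𝒜 0)) := by
    rintro ⟨f, hf⟩
    refine ⟨coeff 0 f, Subtype.ext ?_⟩
    exact (totalDegree_eq_zero_iff_eq_C.1
      ((totalDegree_zero_iff_isHomogeneous _).2 hf)).symm
  have : LocallyOfFiniteType (Spec.map (CommRingCat.ofHom (algebraMap ℂ (𝒜 0)))) :=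
    HasRingHomProperty.Spec_iff.2 (RingHom.FiniteType.of_surjective _ h)
  exact inferInstanceAs (LocallyOfFiniteType (Proj.toSpecZero 𝒜 ≫
    Spec.map (CommRingCat.ofHom (algebraMap ℂ (𝒜 0)))))

instance PP.isLocallyNoetherian (n : ℕ) : IsLocallyNoetherian (PP n) :=
  LocallyOfFiniteType.isLocallyNoetherian (PP.toSpec n)

/-- `B` is closed in a product of two schemes of finite type over `ℂ`. This gives the finite
generation in `IsCoherent.kernel`. -/
instance B.isLocallyNoetherian : IsLocallyNoetherian B := by
  have : IsLocallyNoetherian PPprod :=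
    inferInstanceAs (IsLocallyNoetherian (Limits.pullback (PP.toSpec 3) (PP.toSpec 2)))
  have : IsClosedImmersion B.incl := inferInstanceAs (IsClosedImmersion
    (Scheme.IdealSheafData.vanishingIdeal blowupLocus).subschemeι)
  exact LocallyOfFiniteType.isLocallyNoetherian B.incl

end Noetherian

/-! ### Krull dimension -/

section KrullDim

variable {T : Type*} [TopologicalSpace T]

/-- The trace on a subspace `Z` of an irreducible subset of `Z` is irreducible. -/
lemma isIrreducible_preimage_val {A Z : Set T} (hA : IsIrreducible A) (hAZ : A ⊆ Z) :
    IsIrreducible (Subtype.val ⁻¹' A : Set Z) := by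
  obtain ⟨a, ha⟩ := hA.1
  refine ⟨⟨⟨a, hAZ ha⟩, ha⟩, ?_⟩
  rintro _ _ ⟨u, hu, rfl⟩ ⟨v, hv, rfl⟩ ⟨x, hx, hxu⟩ ⟨y, hy, hyv⟩
  obtain ⟨z, hz, hzuv⟩ := hA.2 u v hu hv ⟨x, hx, hxu⟩ ⟨y, hy, hyv⟩
  exact ⟨⟨z, hAZ hz⟩, hz, hzuv⟩

/-- If every irreducible closed subset is contained in a subset of dimension at most `d`, then
the dimension of the space is at most `d`. -/
lemma topologicalKrullDim_le_of_subset {d : WithBot ℕ∞}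
    (h : ∀ A : IrreducibleCloseds T, ∃ Z : Set T, (A : Set T) ⊆ Z ∧ topologicalKrullDim Z ≤ d) :
    topologicalKrullDim T ≤ d := by
  refine iSup_le fun l ↦ ?_
  obtain ⟨Z, hZ, hd⟩ := h l.last
  -- A whole chain lies inside its last member, hence inside `Z`. Its traces on `Z` therefore still
  -- form a strict chain.
  have hl (i) : (l i : Set T) ⊆ Z :=
    (show (l i : Set T) ⊆ l.last from l.monotone (Fin.le_last i)).trans hZ
  let l' : LTSeries (IrreducibleCloseds Z) :=
    LTSeries.mk l.length (fun i ↦ ⟨Subtype.val ⁻¹' (l i : Set T),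
      isIrreducible_preimage_val (l i).isIrreducible (hl i),
      (l i).isClosed.preimage continuous_subtype_val⟩) fun i j hij ↦ by
        obtain ⟨hle, hne⟩ := l.strictMono hij
        exact ⟨fun x hx ↦ hle hx, fun h' ↦ hne fun x hx ↦ h' (show (⟨x, hl j hx⟩ : Z) ∈ _ from hx)⟩
  exact (Order.LTSeries.length_le_krullDim l').trans hd

/-- The dimension of a union of two closed subsets. -/
lemma topologicalKrullDim_union_le {Y Z : Set T} (hY : IsClosed Y) (hZ : IsClosed Z)
    {d : WithBot ℕ∞} (hYd : topologicalKrullDim Y ≤ d) (hZd : topologicalKrullDim Z ≤ d) :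
    topologicalKrullDim (Y ∪ Z : Set T) ≤ d := by
  refine topologicalKrullDim_le_of_subset fun A ↦ ?_
  have key {W : Set T} (hW : topologicalKrullDim W ≤ d) :
      topologicalKrullDim (Subtype.val ⁻¹' W : Set (Y ∪ Z : Set T)) ≤ d := by
    have : Topology.IsInducing
        (fun x : (Subtype.val ⁻¹' W : Set (Y ∪ Z : Set T)) ↦ (⟨x.1.1, x.2⟩ : W)) :=
      .of_comp (by fun_prop) continuous_subtype_val (show Topology.IsInducing
        (Subtype.val ∘ Subtype.val : (Subtype.val ⁻¹' W : Set (Y ∪ Z : Set T)) → T) from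
        Topology.IsInducing.subtypeVal.comp Topology.IsInducing.subtypeVal)
    exact this.topologicalKrullDim_le.trans hW
  -- An irreducible set covered by two closed sets lies in one of them.
  rcases isPreirreducible_iff_isClosed_union_isClosed.1 A.isIrreducible.2 _ _
    (hY.preimage continuous_subtype_val) (hZ.preimage continuous_subtype_val)
    (fun x _ ↦ x.2) with h | h
  · exact ⟨_, h, key hYd⟩
  · exact ⟨_, h, key hZd⟩

/-- The dimension of a space is bounded by the dimensions of its irreducible components. -/
lemma topologicalKrullDim_le_of_irreducibleComponents {d : WithBot ℕ∞}
    (h : ∀ Z ∈ irreducibleComponents T, topologicalKrullDim Z ≤ d) :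
    topologicalKrullDim T ≤ d := by
  refine topologicalKrullDim_le_of_subset fun A ↦ ?_
  obtain ⟨Z, hZ, hAZ⟩ :=
    exists_mem_irreducibleComponents_subset_of_isIrreducible (A : Set T) A.isIrreducible
  exact ⟨Z, hAZ, h Z hZ⟩

end KrullDim

/-! ### Kernels on affine schemes -/

section Kernel

variable {X : Scheme.{0}}

lemma app_injective {M N : X.Modules} (j : M ⟶ N) [Mono j] (U : X.Opens) :
    Function.Injective (j.app U) := by
  have h1 : Mono ((Scheme.Modules.toPresheaf X).map j) := inferInstance
  have h2 : Mono (((Scheme.Modules.toPresheaf X).map j).app (op U)) := inferInstance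
  exact (AddCommGrpCat.mono_iff_injective _).1 h2

/-- Taking sections over `U` is left exact: both the passage to presheaves and evaluation at `U`
preserve kernels. -/
lemma exists_kernel_app_eq {M Q : X.Modules} (φ : M ⟶ Q) {U : X.Opens} (s : Γ(M, U))
    (hs : φ.app U s = 0) : ∃ k : Γ(Limits.kernel φ, U), (Limits.kernel.ι φ).app U k = s := by
  let F : X.Modules ⥤ Ab := Scheme.Modules.toPresheaf X ⋙ (evaluation _ _).obj (op U)
  have : F.Additive := ⟨fun {_ _ _ _} ↦ rfl⟩
  have : Limits.PreservesLimitsOfShape Limits.WalkingParallelPair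
      ((evaluation X.Opensᵒᵖ Ab.{0}).obj (op U)) :=
    Limits.evaluation_preservesLimitsOfShape (J := Limits.WalkingParallelPair) _
  have : Limits.PreservesLimitsOfShape Limits.WalkingParallelPair F :=
    Limits.comp_preservesLimitsOfShape _ _
  let S : ShortComplex X.Modules := ⟨Limits.kernel.ι φ, φ, Limits.kernel.condition φ⟩
  have hS : S.Exact := S.exact_of_f_is_kernel (Limits.kernelIsKernel φ)
  have : Mono S.f := inferInstanceAs (Mono (Limits.kernel.ι φ))
  have hFS : (S.map F).Exact := hS.map_of_mono_of_preservesKernel F inferInstance inferInstance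
  exact (ShortComplex.ab_exact_iff _).1 hFS s hs

/-- Sections of the restriction over `U` are sections of `M` over the image of `U`, with scalars
transported by `g.appIso`. This reduces quasi-coherence of kernels to spectra. -/
lemma HasPowerTorsion.restrict {Y : Scheme.{0}} (g : X ⟶ Y) [IsOpenImmersion g] {M : Y.Modules}
    (hM : HasPowerTorsion M) : HasPowerTorsion (M.restrict g) := by
  intro U f t ht x hx
  have hle : Y.basicOpen ((g.appIso U).inv f) ≤ g ''ᵁ X.basicOpen f :=
    (Scheme.image_basicOpen g f).ge
  let t' : Γ(M, g ''ᵁ U) := t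
  obtain ⟨V, hV, hxV, n, hn⟩ := hM (g ''ᵁ U) ((g.appIso U).inv f) t'
    ((resSec_resSec M (g.image_mono (X.basicOpen_le f)) hle t').symm.trans
      ((congr_arg (resSec M hle) ht).trans (map_zero _))) (g x) ⟨x, hx, rfl⟩
  have hVU : g ⁻¹ᵁ V ≤ U := fun y hy ↦ by
    obtain ⟨z, hz, hzy⟩ := hV hy
    rwa [← g.isOpenEmbedding.injective hzy]
  refine ⟨g ⁻¹ᵁ V, hVU, hxV, n, ?_⟩
  have hle' : g ''ᵁ (g ⁻¹ᵁ V) ≤ V := g.image_preimage_le V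
  have h := congr_arg (resSec M hle') hn
  rw [resSec_smul, resSec_resSec] at h
  refine Eq.trans (congr_arg (fun r : Γ(Y, g ''ᵁ (g ⁻¹ᵁ V)) ↦ r • resSec M (hle'.trans hV) t')
    (a₁ := (g.appIso _).inv (resFun hVU f ^ n)) ?_) (h.trans (map_zero _))
  rw [resFun, resFun, map_pow, map_pow]
  refine congr_arg (· ^ n) (Eq.trans ?_ (resFun_resFun hV hle' _).symm)
  exact ConcreteCategory.congr_hom (g.appIso_inv_naturality (homOfLE hVU).op) f

/-- On an affine scheme, the kernel of a morphism from a quasi-coherent module to a module with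
power torsion is quasi-coherent. -/
lemma isIso_fromTildeΓ_of_exact {R : CommRingCat.{0}} {K M Q : (Spec R).Modules} (ι : K ⟶ M)
    (φ : M ⟶ Q) (hι : ∀ U, Function.Injective (ι.app U))
    (hιφ : ∀ U k, φ.app U (ι.app U k) = 0)
    (hφ : ∀ U s, φ.app U s = 0 → ∃ k, ι.app U k = s)
    [M.IsQuasicoherent] (hQ : HasPowerTorsion Q) : IsIso K.fromTildeΓ := by
  have hM := (isIso_fromTildeΓ_iff_isLocalizing M).1 inferInstance
  rw [isIso_fromTildeΓ_iff_isLocalizing]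
  intro f
  have hsmul {N : (Spec R).Modules} (n : ℕ) (s : Γ(N, ⊤)) :
      f ^ n • s = ((Scheme.ΓSpecIso R).inv f) ^ n • s := by
    rw [Scheme.Modules.smul_Spec_def, map_pow, map_pow]
    exact congr_arg (fun r : Γ(Spec R, ⊤) ↦ r ^ n • s) (resFun_self le_rfl _)
  have hsmul' {N N' : (Spec R).Modules} (ψ : N ⟶ N') (U : (Spec R).Opens) (r : R) (s : Γ(N, U)) :
      ψ.app U (r • s) = r • ψ.app U s := by
    rw [Scheme.Modules.smul_Spec_def, Scheme.Modules.smul_Spec_def]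
    exact ψ.app_smul _ _
  let D : (Spec R).Opens := PrimeSpectrum.basicOpen f
  have hle : D ≤ ⊤ := le_top
  have hres (N : (Spec R).Modules) (r : R) (s : Γ(N, ⊤)) :
      resSec N hle (r • s) = r • resSec N hle s := N.map_smul_Spec _ r s
  have hMloc : IsLocalizedModule.Away f
    ((modulesSpecToSheaf.obj M).obj.map (PrimeSpectrum.basicOpen f).leTop.op).hom := hM f
  -- It remains to see that `K(⊤) → K(D(f))` is the localization at `f`: that `f` acts invertibly on
  -- the target, that sections extend up to a power of `f`, and that the kernel is `f`-power
  -- torsion.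
  refine IsLocalizedModule.Away.mk_of_addCommGroup
    (Scheme.Modules.isUnit_algebraMap_end_of_le_basicOpen f le_rfl) (fun x ↦ ?_) fun x hx ↦ ?_
  · change Γ(K, D) at x
    -- In `M` the section `fⁿ x` extends to a global `y`. Since `φ y` vanishes on `D(f)`, power
    -- torsion of `Q` gives `fᵐ φ y = 0`, so `fᵐ y` comes from `K` and extends `fᵐ⁺ⁿ x`.
    obtain ⟨n, y, hy⟩ : ∃ (n : ℕ) (y : Γ(M, ⊤)), f ^ n • ι.app D x = resSec M hle y :=
      hMloc.surj _ _ (ι.app D x)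
    obtain ⟨m, hm⟩ : ∃ m : ℕ, f ^ m • φ.app ⊤ y = 0 := by
      obtain ⟨m, hm⟩ := hQ.exists_pow_smul_eq_zero isCompact_univ ((Scheme.ΓSpecIso R).inv f)
        (φ.app ⊤ y) (by
          have : resSec Q hle (φ.app ⊤ y) = 0 := by
            rw [← app_resSec, ← hy, hsmul', hιφ, smul_zero]
          rw [← resSec_resSec Q hle (basicOpen_eq_of_affine f).le, this]
          exact map_zero _)
      exact ⟨m, (hsmul m _).trans hm⟩
    rw [← hsmul'] at hm
    obtain ⟨k, hk⟩ := hφ _ _ hm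
    refine ⟨m + n, k, hι D ?_⟩
    refine Eq.trans (hsmul' ι D _ x) (Eq.trans ?_ (app_resSec ι hle k).symm)
    rw [hk, hres, ← hy, pow_add, mul_smul]
  · change Γ(K, ⊤) at x
    -- This half is inherited from `M` through the injectivity of `ι`.
    obtain ⟨n, hn⟩ : ∃ n : ℕ, f ^ n • ι.app ⊤ x = 0 := by
      have h : resSec M hle (ι.app ⊤ x) = 0 := by
        rw [← app_resSec]
        exact (congr_arg (ι.app D) hx).trans (map_zero _)
      obtain ⟨⟨_, n, rfl⟩, hn⟩ := (IsLocalizedModule.eq_zero_iff (.powers f)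
        ((modulesSpecToSheaf.obj M).obj.map (PrimeSpectrum.basicOpen f).leTop.op).hom).1 h
      exact ⟨n, hn⟩
    exact ⟨n, hι ⊤ ((hsmul' ι ⊤ _ x).trans (hn.trans (map_zero _).symm))⟩

end Kernel

/-! ### Coherence and determinants of kernels -/

variable {X : Scheme.{0}}

lemma kernel_ι_app_app {M Q : X.Modules} (φ : M ⟶ Q) {U : X.Opens} (k : Γ(Limits.kernel φ, U)) :
    φ.app U ((Limits.kernel.ι φ).app U k) = 0 := by
  have h := congr_arg (fun ψ : Limits.kernel φ ⟶ Q ↦ ψ.app U k) (Limits.kernel.condition φ)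
  exact h

/-- Transport of presentations along isomorphisms. -/
def presentationOfIso {M N : X.Modules} (e : M ≅ N) (P : SheafOfModules.Presentation M) :
    SheafOfModules.Presentation N :=
  haveI : @IsIso (SheafOfModules X.ringCatSheaf) _ M N e.hom := (inferInstance : IsIso e.hom)
  SheafOfModules.Presentation.ofIsIso.{0, 0, 0} (R := X.ringCatSheaf) (M := M) (N := N) e.hom P

/-- A module whose restriction to every affine open subset comes from a module over the
coordinate ring is quasi-coherent. -/
lemma isQuasicoherent_of_isIso_fromTildeΓ (K : X.Modules)
    (hK : ∀ (U : X.Opens) (hU : IsAffineOpen U), IsIso (K.restrict hU.fromSpec).fromTildeΓ) :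
    SheafOfModules.IsQuasicoherent (R := X.ringCatSheaf) K := by
  -- The sheaf attached to a module over a ring has a presentation, with all elements as generators;
  -- it is carried to `U` along `U ≅ Spec Γ(X, U)`.
  have pres (U : X.Opens) (hU : IsAffineOpen U) : Nonempty (K.restrict U.ι).Presentation := by
    have := hK U hU
    have P₁ : (K.restrict hU.fromSpec).Presentation :=
      presentationOfIso (asIso (K.restrict hU.fromSpec).fromTildeΓ)
        (presentationTilde.{0} _ .univ (by simp) _ (Submodule.span_eq _))
    let e : K.restrict U.ι ≅ (K.restrict hU.fromSpec).restrict hU.isoSpec.hom :=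
      (Scheme.Modules.restrictFunctorCongr hU.isoSpec_hom_fromSpec.symm).app K ≪≫
        (Scheme.Modules.restrictFunctorComp hU.isoSpec.hom hU.fromSpec).app K
    exact ⟨presentationOfIso e.symm
      (Scheme.Modules.presentationRestrict hU.isoSpec.hom P₁)⟩
  refine SheafOfModules.QuasicoherentData.isQuasicoherent (M := K)
    { I := X.affineOpens
      X := Subtype.val
      coversTop := ?_
      presentation := fun U ↦ ?_ }
  · rw [Opens.coversTop_iff]
    exact iSup_affineOpens_eq_top X
  -- Quasi-coherence asks for presentations on the slice site over `U`. The equivalence with modules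
  -- on the scheme `U` preserves colimits and matches the unit modules (`η`), so presentations
  -- transfer.
  · let E : SheafOfModules.{0} (X.ringCatSheaf.over U.1) ≌
        SheafOfModules.{0} U.1.toScheme.ringCatSheaf := Scheme.Modules.overEquiv U.1
    let η : SheafOfModules.unit (X.ringCatSheaf.over U.1) ≅
        E.inverse.obj (SheafOfModules.unit U.1.toScheme.ringCatSheaf) :=
      E.unitIso.app _ ≪≫ E.inverse.mapIso
        ((Scheme.Modules.overFunctorEquiv U.1).app (.unit X.ringCatSheaf) ≪≫
          Scheme.Modules.restrictUnitIso U.1.ι)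
    have : Limits.PreservesColimitsOfSize.{0, 0} E.inverse := inferInstance
    let P := (pres U.1 U.2).some.map E.inverse η
    let e₀ : @Iso (SheafOfModules U.1.toScheme.ringCatSheaf) _
        ((SheafOfModules.overFunctor X.ringCatSheaf U.1 ⋙ E.functor).obj K) (K.restrict U.1.ι) :=
      (Scheme.Modules.overFunctorEquiv U.1).app K
    let e : E.inverse.obj (K.restrict U.1.ι) ≅ SheafOfModules.over K U.1 :=
      E.inverse.mapIso e₀.symm ≪≫ (E.unitIso.app _).symm
    exact SheafOfModules.Presentation.ofIsIso.{0, 0, 0} e.hom P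

/-- The kernel of a morphism from a quasi-coherent module to a module with power torsion is
quasi-coherent. -/
lemma isQuasicoherent_kernel {M Q : X.Modules} (φ : M ⟶ Q)
    (hM : SheafOfModules.IsQuasicoherent (R := X.ringCatSheaf) M) (hQ : HasPowerTorsion Q) :
    SheafOfModules.IsQuasicoherent (R := X.ringCatSheaf) (Limits.kernel φ) := by
  refine isQuasicoherent_of_isIso_fromTildeΓ _ fun U hU ↦ ?_
  have : SheafOfModules.IsQuasicoherent (R := (Spec Γ(X, U)).ringCatSheaf)
    (M.restrict hU.fromSpec) := Scheme.Modules.isQuasicoherent_restrictFunctor hU.fromSpec M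
  -- Sections of a restriction over `V` are sections over the image of `V`, so exactness on sections
  -- is inherited without identifying the restricted kernel as a kernel.
  refine isIso_fromTildeΓ_of_exact
    ((Scheme.Modules.restrictFunctor hU.fromSpec).map (Limits.kernel.ι φ))
    ((Scheme.Modules.restrictFunctor hU.fromSpec).map φ) (fun V ↦ ?_) (fun V k ↦ ?_)
    (fun V s hs ↦ ?_) (hQ.restrict _)
  · exact app_injective (Limits.kernel.ι φ) (hU.fromSpec ''ᵁ V)
  · exact kernel_ι_app_app φ (U := hU.fromSpec ''ᵁ V) k
  · exact exists_kernel_app_eq φ (U := hU.fromSpec ''ᵁ V) s hs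

/-- On a locally noetherian scheme, the kernel of a morphism from a coherent module to a module
with power torsion is coherent. -/
lemma IsCoherent.kernel [IsLocallyNoetherian X] {M Q : X.Modules} (φ : M ⟶ Q) (hM : IsCoherent M)
    (hQ : HasPowerTorsion Q) : IsCoherent (Limits.kernel φ) where
  quasicoherent := isQuasicoherent_kernel φ hM.quasicoherent hQ
  finite U hU := by
    have : IsNoetherianRing Γ(X, U) := IsLocallyNoetherian.component_noetherian ⟨U, hU⟩
    have := hM.finite U hU
    exact Module.Finite.of_injective
      ({ toFun := (Limits.kernel.ι φ).app U
         map_add' := map_add _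
         map_smul' := Scheme.Modules.Hom.app_smul _ } :
        Γ(Limits.kernel φ, U) →ₗ[Γ(X, U)] Γ(M, U))
      (app_injective _ U)

/-! ### Torsion-freeness, frames and determinants along a morphism -/

lemma IsTorsionFree.of_mono {M N : X.Modules} (j : M ⟶ N) [Mono j] (hN : IsTorsionFree N) :
    IsTorsionFree M := fun U f s hf hs ↦ by
  refine app_injective j U ((hN U f _ hf ?_).trans (map_zero _).symm)
  rw [← Scheme.Modules.Hom.app_smul, hs, map_zero]

/-- Frames are transported by morphisms which are bijective on sections over small open sets. -/
lemma IsFrame.of_bijective {M N : X.Modules} (j : M ⟶ N) {r : ℕ} {V : X.Opens}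
    (hj : ∀ W ≤ V, Function.Bijective (j.app W)) {e : Fin r → Γ(M, V)}
    (he : IsFrame N V fun i ↦ j.app V (e i)) : IsFrame M V e := by
  intro W hW
  refine (Function.Bijective.of_comp_iff' (hj W hW) _).1 ?_
  convert he W hW using 1
  ext c
  simp only [Function.comp_apply, map_sum, Scheme.Modules.Hom.app_smul, app_resSec]

lemma IsFrame.restrict {M : X.Modules} {r : ℕ} {V W : X.Opens} {e : Fin r → Γ(M, V)}
    (he : IsFrame M V e) (h : W ≤ V) : IsFrame M W fun i ↦ resSec M h (e i) := by
  intro W' hW'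
  simpa only [resSec_resSec] using he W' (hW'.trans h)

/-- A determinant on `U` of a module `N` is a determinant, on a smaller open set `U'`, of every
module `M` with a morphism to `N` that is an isomorphism over `U'`. -/
lemma HasDeterminantOn.of_bijective {M N L : X.Modules} {r : ℕ} {U U' : X.Opens} (j : M ⟶ N)
    (hU : U' ≤ U) (hj : ∀ W ≤ U', Function.Bijective (j.app W))
    (hN : HasDeterminantOn N r L U) : HasDeterminantOn M r L U' := by
  obtain ⟨ω, hω, hfr⟩ := hN
  let jl (V : X.Opens) : Γ(M, V) →ₗ[Γ(X, V)] Γ(N, V) :=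
    { toFun := j.app V
      map_add' := map_add _
      map_smul' := Scheme.Modules.Hom.app_smul _ }
  -- The determinant form is pulled back along `j`. Frames of `N` lift to `M` once they are
  -- restricted into `U'`.
  refine ⟨fun V hV ↦ (ω V (hV.trans hU)).compLinearMap (jl V), fun V W hV hW m ↦ ?_,
    fun x hx ↦ ?_⟩
  · refine (hω V W _ hW _).trans (congr_arg (ω W _) (funext fun i ↦ ?_))
    exact (app_resSec j hW (m i)).symm
  · obtain ⟨V, hV, hxV, e, he, hωe⟩ := hfr x (hU hx)
    have hVU' : V ⊓ U' ≤ U' := inf_le_right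
    choose e' he' using fun i ↦ (hj _ hVU').2 (resSec N (inf_le_left : V ⊓ U' ≤ V) (e i))
    have he' : (fun i ↦ j.app _ (e' i)) = fun i ↦ resSec N inf_le_left (e i) := funext he'
    refine ⟨V ⊓ U', hVU', ⟨hxV, hx⟩, e', .of_bijective j (fun W hW ↦ hj W (hW.trans hVU')) ?_, ?_⟩
    · rw [he']
      exact he.restrict _
    · have h : ω (V ⊓ U') (hVU'.trans hU) (fun i ↦ j.app _ (e' i)) =
          resSec L inf_le_left (ω V hV e) := by
        rw [he', hω V _ hV inf_le_left]
      have h' := hωe.restrict (inf_le_left : V ⊓ U' ≤ V)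
      rw [← h] at h'
      exact h'
end

end InstantonBlowup

/-! ### Stability of the elementary transform -/

theorem mainTheorem8 (E : B.Modules) (hE : IsInstanton E 2) (hst : IsMuStable E)
    {S : Scheme.{0}} (i : S ⟶ B) (L : S.Modules) (φ : E ⟶ twist (direct i L) 2 (-1))
    (hφ : IsElementaryDatum E i L φ) :
    IsMuStable (elementaryTransform φ) := by
  have hi : IsClosedImmersion i := hφ.curve.closedImmersion
  have hQ : HasPowerTorsion (twist (direct i L) 2 (-1)) :=
    (hφ.line.hasPowerTorsion.pushforward i).tensor (B.isLocallyFreeOfRank_O 2 (-1))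
  change IsMuStable (Limits.kernel φ)
  obtain ⟨r, D, hr, ⟨U, hU, hdet⟩, hslope⟩ := hst.slope_lt
  -- The rank and class witnessing the stability of `E` serve unchanged for the kernel.
  refine ⟨hst.coherent.kernel φ hQ, hst.torsionFree.of_mono (Limits.kernel.ι φ), r, D, hr, ?_,
    fun G j hj hG s D' hD' hs hsr ↦ ?_⟩
  -- Off the curve the target of `φ` vanishes, so the inclusion of the kernel is bijective on
  -- sections there.
  · let Z : B.Opens := ⟨(Set.range i)ᶜ, i.isClosedEmbedding.isClosed_range.isOpen_compl⟩
    refine ⟨U ⊓ Z, ?_, hdet.of_bijective (Limits.kernel.ι φ) inf_le_left fun W hW ↦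
      ⟨app_injective _ W, fun s ↦ exists_kernel_app_eq φ s ?_⟩⟩
    · have hset : ((U ⊓ Z : B.Opens) : Set B)ᶜ = (U : Set B)ᶜ ∪ Set.range i := by
        rw [Opens.coe_inf, Set.compl_inter]
        exact congr_arg ((U : Set B)ᶜ ∪ ·) (compl_compl _)
      rw [hset]
      refine topologicalKrullDim_union_le U.2.isClosed_compl i.isClosedEmbedding.isClosed_range hU ?_
      -- The image of `i` is homeomorphic to `S`, all of whose irreducible components have dimension
      -- one.
      rw [← IsHomeomorph.topologicalKrullDim_eq _
        i.isClosedEmbedding.isEmbedding.toHomeomorph.isHomeomorph]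
      exact topologicalKrullDim_le_of_irreducibleComponents fun A hA ↦ (hφ.curve.pure_dim A hA).le
    · have : Subsingleton Γ(twist (direct i L) 2 (-1), W) :=
        subsingleton_tensor fun V hV ↦ by
          -- `V` misses the curve, so sections of the direct image over `V` are sections of `L` over
          -- the empty set.
          have hV' : i ⁻¹ᵁ V = ⊥ := by
            ext x
            exact iff_of_false (fun hx ↦ (hW (hV hx)).2 ⟨x, rfl⟩) id
          refine subsingleton_of_forall_eq 0 fun t ↦ eq_zero_of_locally L (U := i ⁻¹ᵁ V) t
            fun x hx ↦ ?_
          rw [hV'] at hx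
          exact hx.elim
      exact Subsingleton.elim _ _
  -- Composing with the inclusion makes `G` a subsheaf of `E`, to which stability of `E` applies.
  · have := mono_comp j (Limits.kernel.ι φ)
    exact hslope G (j ≫ Limits.kernel.ι φ) this hG s D' hD' hs hsr
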